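/- All schemes are over $\mathbb C$. Let $S$ be a smooth projective (irreducible) surface with a non-trivial algebraic semigroup law $\mu : S\times S\to S$. Non-trivial means: there are a complete irreducible curve $C$, a morphism $\pi : S\to C$ with a section $\sigma : C\to S$ (so $\pi\circ\sigma=\mathrm{id}_C$), and a law $\tilde\mu$ on $C$ with $$\mu(s_1,s_2)=\sigma\bigl(\tilde\mu(\pi(s_1),\pi(s_2))\bigr),$$ where either $C$ is an elliptic curve and $\tilde\mu$ is its group law, or $\tilde\mu(x_1,x_2)=x_1$, or $\tilde\mu(x_1,x_2)=x_2$. Let $P$ be an arbitrary closed point of $S$ and let $\varphi : S'\to S$ be the blowing-up of $P$. Then there is exactly one non-trivial algebraic semigroup law $\mu'$ on $S'$ (non-trivial in the same sense) such that $\varphi : (S',\mu')\to(S,\mu)$ is a homomorphism. Moreover, for any data $(C,\pi,\sigma,\tilde\mu)$ presenting $\mu$ as above, let $C'\subset S'$ be the strict transform of $\sigma(C)$, that is, the closure of $\varphi^{-1}(\sigma(C)\setminus\{P\})$ with its reduced structure. There is a closed immersion $\sigma' : C\to S'$ with image $C'$ and $\varphi\circ\sigma'=\sigma$; it is a section of $\pi'=\pi\circ\varphi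 : S'\to C$, and $$\mu'(s_1',s_2')=\sigma'\bigl(\tilde\mu(\pi'(s_1'),\pi'(s_2'))\bigr).$$ -/

import Mathlib

open CategoryTheory MonoidalCategory CartesianMonoidalCategory AlgebraicGeometry TopologicalSpace

noncomputable section

namespace AlgSemigroup

/-- The category of schemes over the field of complex numbers (a cartesian monoidal category:
`X ⊗ Y` is the product `X × Y` over `ℂ`). -/
abbrev SchC : Type 1 := Over (Spec (CommRingCat.of ℂ))

/-! ### Projective surfaces and complete curves -/

section ProjectiveSpace

attribute [local instance] MvPolynomial.gradedAlgebra

/-- Projective space of dimension `n` over `ℂ`: the scheme `Proj ℂ[X₀, …, Xₙ]` with its structure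
morphism `Proj ℂ[X₀, …, Xₙ] ⟶ Spec ℂ[X₀, …, Xₙ]₀ ⟶ Spec ℂ`. -/
def projectiveSpace (n : ℕ) : SchC :=
  Over.mk
    (Proj.toSpecZero (MvPolynomial.homogeneousSubmodule (Fin (n + 1)) ℂ) ≫
      Spec.map (CommRingCat.ofHom
        (algebraMap ℂ (MvPolynomial.homogeneousSubmodule (Fin (n + 1)) ℂ 0))))

end ProjectiveSpace

/-- A `ℂ`-scheme is projective if it is isomorphic to a closed subscheme of some `ℙⁿ`. -/
def IsProjective (X : SchC) : Prop :=
  ∃ (n : ℕ) (i : X ⟶ projectiveSpace n), IsClosedImmersion i.left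

/-- A smooth projective (irreducible) surface over `ℂ`. -/
structure IsSmoothProjectiveSurface (S : SchC) : Prop where
  isIntegral : IsIntegral S.left
  smooth : Smooth S.hom
  projective : IsProjective S
  dim_eq_two : topologicalKrullDim S.left = 2

/-- A complete (irreducible) curve over `ℂ`: a complete variety of dimension one. It is not
required to be smooth. -/
structure IsCompleteCurve (C : SchC) : Prop where
  isIntegral : IsIntegral C.left
  proper : IsProper C.hom
  dim_eq_one : topologicalKrullDim C.left = 1

/-! ### Algebraic semigroup laws -/

/-- A morphism `μ : S × S ⟶ S` over `ℂ` is an algebraic semigroup law if it is associative. -/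
def IsSemigroupLaw {S : SchC} (μ : S ⊗ S ⟶ S) : Prop :=
  (μ ▷ S) ≫ μ = (α_ S S S).hom ≫ (S ◁ μ) ≫ μ

/-- `φ` is a homomorphism from `(S', μ')` to `(S, μ)`: `φ (μ' (a, b)) = μ (φ a, φ b)`. -/
def IsSemigroupHom {S' S : SchC} (μ' : S' ⊗ S' ⟶ S') (μ : S ⊗ S ⟶ S) (φ : S' ⟶ S) : Prop :=
  μ' ≫ φ = (φ ⊗ₘ φ) ≫ μ

/-- The law `(s₁, s₂) ↦ σ (ν (π s₁, π s₂))`. -/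
def contractionLaw {S C : SchC} (π : S ⟶ C) (σ : C ⟶ S) (ν : C ⊗ C ⟶ C) : S ⊗ S ⟶ S :=
  (π ⊗ₘ π) ≫ ν ≫ σ

/-- The three kinds of laws on the kernel of a non-trivial semigroup law: the group law of a group
variety (for a complete curve `C`, of an elliptic curve), `(x₁, x₂) ↦ x₁` and `(x₁, x₂) ↦ x₂`. -/
def IsKernelLaw {C : SchC} (ν : C ⊗ C ⟶ C) : Prop :=
  (∃ G : GrpObj C, ν = G.mul) ∨ ν = fst C C ∨ ν = snd C C

/-- `(C, π, σ, ν)` presents `μ` as a non-trivial law: `C` is a complete curve, `σ` is a section of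
`π : S ⟶ C`, `ν` is an elliptic curve group law or one of the two projections, and
`μ (s₁, s₂) = σ (ν (π s₁, π s₂))`. -/
structure IsNontrivialPresentation {S C : SchC} (μ : S ⊗ S ⟶ S)
    (π : S ⟶ C) (σ : C ⟶ S) (ν : C ⊗ C ⟶ C) : Prop where
  curve : IsCompleteCurve C
  isSection : σ ≫ π = 𝟙 C
  kernelLaw : IsKernelLaw ν
  law_eq : μ = contractionLaw π σ ν

/-- The law `μ` on `S` is non-trivial. -/
def IsNontrivialLaw {S : SchC} (μ : S ⊗ S ⟶ S) : Prop :=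
  ∃ (C : SchC) (π : S ⟶ C) (σ : C ⟶ S) (ν : C ⊗ C ⟶ C), IsNontrivialPresentation μ π σ ν

/-! ### Blowing up a closed point -/

/-- The closed subscheme defined by `I` is an effective Cartier divisor: `I` is locally generated
by one nonzerodivisor. -/
def IsEffectiveCartier {X : Scheme.{0}} (I : X.IdealSheafData) : Prop :=
  ∀ x : X, ∃ U : X.affineOpens, x ∈ U.1 ∧
    ∃ f ∈ nonZeroDivisors Γ(X, U.1), I.ideal U = Ideal.span {f}

/-- The ideal sheaf of the closed point `p` with its reduced structure. -/
def pointIdeal {X : Scheme.{0}} (p : X) (hp : IsClosed ({p} : Set X)) : X.IdealSheafData :=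
  Scheme.IdealSheafData.vanishingIdeal (⟨{p}, hp⟩ : Closeds X)

/-- `φ : X' ⟶ X` is the blowing-up of the closed point `p`: it is terminal among the morphisms to
`X` under which the scheme-theoretic inverse image of `p` is an effective Cartier divisor. -/
structure IsBlowUpAt {X' X : Scheme.{0}} (φ : X' ⟶ X) (p : X) (hp : IsClosed ({p} : Set X)) :
    Prop where
  isEffectiveCartier : IsEffectiveCartier ((pointIdeal p hp).comap φ)
  existsUnique_lift : ∀ (T : Scheme.{0}) (f : T ⟶ X),
    IsEffectiveCartier ((pointIdeal p hp).comap f) → ∃! g : T ⟶ X', g ≫ φ = f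

/-- The underlying closed set of the strict transform under `φ : X' ⟶ X` of `Z ⊆ X`, where `φ`
is the blowing-up of `p`: the closure of `φ⁻¹(Z ∖ {p})`. -/
def strictTransform {X' X : Scheme.{0}} (φ : X' ⟶ X) (p : X) (Z : Set X) : Set X' :=
  closure ((φ : X' → X) ⁻¹' (Z \ {p}))

end AlgSemigroup

end

/-! Everything comes from the universal property of the blow-up: a morphism to `S` lifts to `S'`,
uniquely, once the inverse image of `P` is a Cartier divisor. The curve `C` is a retract of the
smooth, hence normal, surface `S`, so its local rings are principal. As `σ` is injective and `C` has
several points, `σ⁻¹(P)` is a nonzero ideal, hence Cartier, and `σ` lifts to `σ'`. This gives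
existence of the law. For uniqueness, a competing `μ'` agrees after `φ` with `σ ∘ ν ∘ (π' × π')`.
The map `π'` is flat, being dominant from an integral scheme to `C`, and `ν` is flat, so the inverse
image of `P` in `S' × S'` is a flat pullback of `σ⁻¹(P)`, again Cartier; the lift is therefore
unique. The same principle shows that `σ'` is a closed immersion
(`IsBlowUpAt.isClosedImmersion_lift`). -/

/-! ### Commutative algebra: normality -/

/-- If `a / b` is integral over `A`, then `i a = y * i b` with `y` in `B`; applying `r` gives `a = r
y * b`. -/
theorem isIntegrallyClosed_of_retract {A B : Type*} [CommRing A] [CommRing B] [IsDomain A]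
    [IsDomain B] [IsIntegrallyClosed B] (i : A →+* B) (r : B →+* A) (h : r.comp i = RingHom.id A) :
    IsIntegrallyClosed A := by
  have hr (a : A) : r (i a) = a := congr($h a)
  have hi : Function.Injective i := Function.LeftInverse.injective hr
  rw [isIntegrallyClosed_iff (FractionRing A)]
  intro x hx
  obtain ⟨a, b, hb, rfl⟩ := IsFractionRing.div_surjective (A := A) x
  let j : FractionRing A →+* FractionRing B :=
    IsFractionRing.map (K := FractionRing A) (L := FractionRing B) hi
  have hj (a : A) : j (algebraMap _ _ a) = algebraMap _ _ (i a) := IsLocalization.map_eq _ a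
  have hint : IsIntegral B (j (algebraMap A _ a / algebraMap A _ b)) := by
    obtain ⟨p, hp, hpx⟩ := hx
    refine ⟨p.map i, hp.map i, ?_⟩
    rw [Polynomial.eval₂_map]
    have : (algebraMap B (FractionRing B)).comp i = j.comp (algebraMap A _) := by
      ext; simp [hj]
    rw [this, ← Polynomial.hom_eval₂, hpx, map_zero]
  obtain ⟨y, hy⟩ := (IsIntegrallyClosed.isIntegral_iff (K := FractionRing B)).mp hint
  have hb0 : algebraMap A (FractionRing A) b ≠ 0 :=
    IsFractionRing.to_map_ne_zero_of_mem_nonZeroDivisors hb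
  have hbB : algebraMap B (FractionRing B) (i b) ≠ 0 := by
    rw [← hj]; simpa using hb0
  refine ⟨r y, ?_⟩
  rw [eq_div_iff hb0, ← map_mul]
  congr 1
  rw [map_div₀, hj, hj, eq_div_iff hbB, ← map_mul] at hy
  have := IsFractionRing.injective B (FractionRing B) hy
  simpa [hr] using congr(r $this)

-- Integral closure commutes with étale base change, and `S ⊗ Frac P`, a domain finite over `Frac
-- P`, is the fraction field of `S`.
open scoped TensorProduct nonZeroDivisors in
attribute [local instance] Algebra.TensorProduct.rightAlgebra in
theorem isIntegrallyClosed_of_etale {P S : Type*} [CommRing P] [IsDomain P] [IsIntegrallyClosed P]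
    [CommRing S] [IsDomain S] [Algebra P S] [Algebra.Etale P S] : IsIntegrallyClosed S := by
  let F := FractionRing P
  have hbij := TensorProduct.toIntegralClosure_bijective_of_smooth (R := P) (S := S) (B := F)
  have hinj : Function.Injective (algebraMap P S) := FaithfulSMul.algebraMap_injective P S
  have hle : Algebra.algebraMapSubmonoid S P⁰ ≤ S⁰ := by
    rintro _ ⟨p, hp, rfl⟩
    exact mem_nonZeroDivisors_of_ne_zero
      ((map_ne_zero_iff _ hinj).mpr (nonZeroDivisors.ne_zero hp))
  have hloc : IsLocalization (Algebra.algebraMapSubmonoid S P⁰) (S ⊗[P] F) := by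
    have : Algebra.IsPushout P S F (S ⊗[P] F) := inferInstance
    exact (Algebra.isLocalization_iff_isPushout (A := F) P⁰ (T := S) (B := S ⊗[P] F)).mpr this
  have : IsDomain (S ⊗[P] F) := IsLocalization.isDomain_of_le_nonZeroDivisors _ hle
  have e : F ⊗[P] S ≃ₐ[F] S ⊗[P] F :=
    { Algebra.TensorProduct.comm P F S with commutes' := fun r => by simp; rfl }
  have : Algebra.Etale F (S ⊗[P] F) := .of_equiv e
  have : Module.Finite F (S ⊗[P] F) := Algebra.FormallyUnramified.finite_of_free F _
  have hfield : IsField (S ⊗[P] F) := isField_of_isIntegral_of_isField' (Field.toIsField F)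
  let _ := hfield.toField
  have : IsFractionRing S (S ⊗[P] F) := by
    refine IsLocalization.of_le _ _ hle fun r hr => ?_
    refine IsUnit.mk0 _ ?_
    exact (map_ne_zero_iff _ (IsLocalization.injective _ hle)).mpr (nonZeroDivisors.ne_zero hr)
  rw [isIntegrallyClosed_iff (S ⊗[P] F)]
  intro x hx
  obtain ⟨y, hy⟩ := hbij.2 ⟨x, hx⟩
  replace hy : (TensorProduct.toIntegralClosure P S F y : S ⊗[P] F) = x := congr($hy.1)
  rw [← hy]
  clear hy
  induction y with
  | zero => exact ⟨0, by simp⟩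
  | add a b ha hb =>
    obtain ⟨a', ha⟩ := ha
    obtain ⟨b', hb⟩ := hb
    exact ⟨a' + b', by simp [ha, hb]⟩
  | tmul s f =>
    obtain ⟨p, hp⟩ := (IsIntegrallyClosed.isIntegral_iff (K := F)).mp f.2
    refine ⟨p • s, ?_⟩
    change _ = s ⊗ₜ[P] (f : F)
    rw [← hp, Algebra.TensorProduct.algebraMap_apply, Algebra.algebraMap_self, RingHom.id_apply,
      TensorProduct.smul_tmul, Algebra.smul_def, mul_one]

/-- Near `p` the algebra is étale over a polynomial ring, which is normal. -/
theorem isIntegrallyClosed_of_isSmoothAt {k S : Type*} [Field k] [CommRing S] [IsDomain S]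
    [Algebra k S] [Algebra.FinitePresentation k S] (p : Ideal S) [p.IsPrime]
    [Algebra.IsSmoothAt k p] : IsIntegrallyClosed (Localization.AtPrime p) := by
  obtain ⟨f, hf, n, _, _, _⟩ :=
    Algebra.IsSmoothAt.exists_isStandardEtale_mvPolynomial (R := k) (p := p)
  have hf0 : f ≠ 0 := fun h => hf (h ▸ p.zero_mem)
  have : IsDomain (Localization.Away f) :=
    IsLocalization.isDomain_localization (powers_le_nonZeroDivisors_of_noZeroDivisors hf0)
  have : IsIntegrallyClosed (Localization.Away f) :=
    isIntegrallyClosed_of_etale (P := MvPolynomial (Fin n) k)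
  have hle : Submonoid.powers f ≤ p.primeCompl := Submonoid.powers_le.mpr hf
  let := IsLocalization.localizationAlgebraOfSubmonoidLe (Localization.Away f) (Localization.AtPrime p) _ _ hle
  have := IsLocalization.localization_isScalarTower_of_submonoid_le
    (Localization.Away f) (Localization.AtPrime p) _ _ hle
  have := IsLocalization.isLocalization_of_submonoid_le
    (Localization.Away f) (Localization.AtPrime p) _ _ hle
  refine isIntegrallyClosed_of_isLocalization (R := Localization.Away f) _
    (p.primeCompl.map (algebraMap S (Localization.Away f))) ?_
  rintro _ ⟨x, hx, rfl⟩
  refine mem_nonZeroDivisors_of_ne_zero ((map_ne_zero_iff _ (IsLocalization.injective _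
    (powers_le_nonZeroDivisors_of_noZeroDivisors hf0))).mpr ?_)
  rintro rfl
  exact hx p.zero_mem

theorem isPrincipalIdealRing_of_krullDimLE_one (R : Type*) [CommRing R] [IsDomain R] [IsLocalRing R]
    [IsNoetherianRing R] [IsIntegrallyClosed R] [Ring.KrullDimLE 1 R] : IsPrincipalIdealRing R := by
  have : Ring.DimensionLEOne R :=
    ⟨fun {p} hp hp' => Ring.krullDimLE_one_iff_of_isPrime_bot.mp ‹_› p hp hp'⟩
  have : IsDedekindDomain R := { }
  infer_instance

/-! ### Local rings of smooth schemes and flatness over a curve -/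

namespace AlgebraicGeometry

theorem isIntegrallyClosed_stalk_of_smooth {k : Type} [Field k] {X : Scheme.{0}} [IsIntegral X]
    (f : X ⟶ Spec (.of k)) [Smooth f] (x : X) : IsIntegrallyClosed (X.presheaf.stalk x) := by
  obtain ⟨_, ⟨U, hU, rfl⟩, hxU, -⟩ :=
    X.isBasis_affineOpens.exists_subset_of_mem_open (Set.mem_univ x) isOpen_univ
  have hf := f.smooth_appLE (isAffineOpen_top (Spec (.of k))) hU le_top
  have : Nonempty U := ⟨⟨x, hxU⟩⟩
  let _ : Field Γ(Spec (.of k), ⊤) := (isField_of_isIntegral_of_subsingleton (Spec (.of k))).toField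
  algebraize [(f.appLE ⊤ U le_top).hom]
  have : Algebra.IsSmoothAt Γ(Spec (.of k), ⊤) (hU.primeIdealOf ⟨x, hxU⟩).asIdeal := inferInstance
  have := isIntegrallyClosed_of_isSmoothAt (k := Γ(Spec (.of k), ⊤)) (S := Γ(X, U))
    (hU.primeIdealOf ⟨x, hxU⟩).asIdeal
  let _ := TopCat.Presheaf.algebra_section_stalk X.presheaf (⟨x, hxU⟩ : U)
  have := hU.isLocalization_stalk ⟨x, hxU⟩
  exact IsIntegrallyClosed.of_equiv (IsLocalization.algEquiv
    (hU.primeIdealOf ⟨x, hxU⟩).asIdeal.primeCompl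
    (Localization.AtPrime (hU.primeIdealOf ⟨x, hxU⟩).asIdeal) (X.presheaf.stalk x)).toRingEquiv

theorem krullDimLE_stalk {X : Scheme.{0}} {n : ℕ} (h : topologicalKrullDim X ≤ n) (x : X) :
    Ring.KrullDimLE n (X.presheaf.stalk x) := by
  rw [Ring.krullDimLE_iff, ← PrimeSpectrum.topologicalKrullDim_eq_ringKrullDim]
  exact (X.fromSpecStalk x).isEmbedding.isInducing.topologicalKrullDim_le.trans h

theorem isIntegrallyClosed_stalk_of_section {X Y : Scheme.{0}} [IsIntegral X] [IsIntegral Y]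
    (p : X ⟶ Y) (s : Y ⟶ X) (h : s ≫ p = 𝟙 Y) (y : Y)
    [IsIntegrallyClosed (X.presheaf.stalk (s y))] : IsIntegrallyClosed (Y.presheaf.stalk y) := by
  have : IsIso (s ≫ p) := by rw [h]; infer_instance
  let e : Y.presheaf.stalk (p (s y)) ⟶ Y.presheaf.stalk y := (s ≫ p).stalkMap y
  have : IsIso e := inferInstanceAs (IsIso ((s ≫ p).stalkMap y))
  have he : e = p.stalkMap (s y) ≫ s.stalkMap y := Scheme.Hom.stalkMap_comp s p y
  have hid : (inv e ≫ p.stalkMap (s y)) ≫ s.stalkMap y = 𝟙 _ := by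
    rw [Category.assoc, ← he, IsIso.inv_hom_id]
  exact isIntegrallyClosed_of_retract (inv e ≫ p.stalkMap (s y)).hom (s.stalkMap y).hom
    congr(($hid).hom)

/-- Dominance makes the stalk maps injective, and a torsion-free module over a principal ideal
domain is flat. -/
theorem flat_of_isDominant {X Y : Scheme.{0}} [IsIntegral X] [IsIntegral Y] (f : X ⟶ Y) [IsDominant f]
    (hY : ∀ y : Y, IsPrincipalIdealRing (Y.presheaf.stalk y)) : Flat f := by
  refine Flat.of_stalkMap _ fun x => ?_
  have := hY (f x)
  have hinj : Function.Injective (f.stalkMap x) := by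
    obtain ⟨_, ⟨U, hU, rfl⟩, hxU, -⟩ :=
      Y.isBasis_affineOpens.exists_subset_of_mem_open (Set.mem_univ (f x)) isOpen_univ
    refine hU.stalkMap_injective f x hxU fun g hg => ?_
    rw [Scheme.Hom.germ_stalkMap_apply] at hg
    have hg0 : f.app U g = 0 := by
      refine germ_injective_of_isIntegral X x (show x ∈ f ⁻¹ᵁ U from hxU) ?_
      rw [hg, map_zero]
    suffices g = 0 by rw [this, map_zero]
    rw [← AlgebraicGeometry.basicOpen_eq_bot_iff]
    by_contra hne
    obtain ⟨y, hy⟩ := (Opens.ne_bot_iff_nonempty _).mp hne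
    obtain ⟨z, hz⟩ := f.denseRange.exists_mem_open (Y.basicOpen g).2 ⟨y, hy⟩
    have : z ∈ f ⁻¹ᵁ Y.basicOpen g := hz
    rw [Scheme.preimage_basicOpen, hg0, Scheme.basicOpen_zero] at this
    exact this
  let _ := (f.stalkMap x).hom.toAlgebra
  have : FaithfulSMul (Y.presheaf.stalk (f x)) (X.presheaf.stalk x) :=
    (faithfulSMul_iff_algebraMap_injective _ _).mpr hinj
  exact (inferInstance : Module.Flat (Y.presheaf.stalk (f x)) (X.presheaf.stalk x))

end AlgebraicGeometry

/-! ### Inverse images of ideal sheaves on affine opens -/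

namespace AlgebraicGeometry.Scheme.IdealSheafData

universe u
variable {X Y : Scheme.{u}}

theorem ideal_comap_top_of_isAffine [IsAffine X] [IsAffine Y] (I : Y.IdealSheafData) (f : X ⟶ Y) :
    (I.comap f).ideal ⟨⊤, isAffineOpen_top X⟩ =
      (I.ideal ⟨⊤, isAffineOpen_top Y⟩).map f.appTop.hom := by
  apply le_antisymm
  · have h : I.comap f ≤ ofIdealTop ((I.ideal ⟨⊤, isAffineOpen_top Y⟩).map f.appTop.hom) := by
      rw [← le_map_iff_comap_le]
      apply le_of_isAffine
      rw [ideal_map_of_isAffineHom, ← Ideal.map_le_iff_le_comap]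
      change _ ≤ (ofIdealTop _).ideal ⟨⊤, isAffineOpen_top X⟩
      rw [ofIdealTop_ideal]
      simp only [homOfLE_refl, op_id, CategoryTheory.Functor.map_id, CommRingCat.hom_id,
        Ideal.map_id]
      exact le_rfl
    refine (h _).trans ?_
    rw [ofIdealTop_ideal]
    simp
  · rw [Ideal.map_le_iff_le_comap]
    have := le_map_comap I f ⟨⊤, isAffineOpen_top Y⟩
    rwa [ideal_map_of_isAffineHom] at this

theorem ideal_comap_ι_top (I : X.IdealSheafData) (V : X.affineOpens) [IsAffine V.1] :
    (I.comap V.1.ι).ideal ⟨⊤, isAffineOpen_top V.1.toScheme⟩ =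
      (I.ideal V).map V.1.topIso.inv.hom := by
  rw [ideal_comap_of_isOpenImmersion]
  have := map_ideal' I (V := V) (U := ⟨V.1.ι ''ᵁ ⊤,
    (isAffineOpen_top V.1.toScheme).image_of_isOpenImmersion _⟩) (homOfLE (show V.1.ι ''ᵁ ⊤ ≤ V.1 by simp)).op
  simp only [Opens.ι_appIso]
  exact this.symm

theorem ideal_comap (I : Y.IdealSheafData) (f : X ⟶ Y) (U : Y.affineOpens) (V : X.affineOpens)
    (h : V.1 ≤ f ⁻¹ᵁ U.1) : (I.comap f).ideal V = (I.ideal U).map (f.appLE U V h).hom := by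
  have : IsAffine U.1 := U.2
  have : IsAffine V.1 := V.2
  have hc : (I.comap f).comap V.1.ι = (I.comap U.1.ι).comap (f.resLE U.1 V.1 h) := by
    rw [← comap_comp, ← comap_comp, Scheme.Hom.resLE_comp_ι]
  have h1 := ideal_comap_ι_top (I.comap f) V
  rw [hc, ideal_comap_top_of_isAffine, ideal_comap_ι_top, Ideal.map_map, ← CommRingCat.hom_comp,
    Scheme.Hom.appTop, Scheme.Hom.resLE_app_top, Iso.inv_hom_id_assoc] at h1
  have h2 := congr(Ideal.map V.1.topIso.hom.hom $h1)
  rw [Ideal.map_map, Ideal.map_map, ← CommRingCat.hom_comp, ← CommRingCat.hom_comp, Category.assoc,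
    Iso.inv_hom_id, Category.comp_id, CommRingCat.hom_id, Ideal.map_id] at h2
  exact h2.symm

end AlgebraicGeometry.Scheme.IdealSheafData

/-! ### Effective Cartier divisors -/

namespace AlgSemigroup

variable {X Y : Scheme.{0}}

theorem IsEffectiveCartier.comap_of_flat {I : Y.IdealSheafData} (hI : IsEffectiveCartier I)
    (f : X ⟶ Y) [Flat f] : IsEffectiveCartier (I.comap f) := by
  intro x
  obtain ⟨U, hxU, t, ht, hIt⟩ := hI (f x)
  obtain ⟨_, ⟨V, hV, rfl⟩, hxV, hVU⟩ :=
    X.isBasis_affineOpens.exists_subset_of_mem_open (show x ∈ f ⁻¹ᵁ U.1 from hxU) (f ⁻¹ᵁ U.1).2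
  refine ⟨⟨V, hV⟩, hxV, f.appLE U V hVU t, ?_, ?_⟩
  · have := f.flat_appLE U.2 hV hVU
    algebraize [(f.appLE U V hVU).hom]
    have hreg := Module.Flat.isSMulRegular_of_nonZeroDivisors (M := Γ(X, V)) ht
    refine mem_nonZeroDivisors_iff_right.mpr fun a ha => hreg ?_
    change t • a = t • 0
    rw [smul_zero, Algebra.smul_def, mul_comm]
    exact ha
  · rw [Scheme.IdealSheafData.ideal_comap I f U ⟨V, hV⟩ hVU, hIt, Ideal.map_span,
      Set.image_singleton]

theorem isEffectiveCartier_top : IsEffectiveCartier (⊤ : X.IdealSheafData) := by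
  intro x
  obtain ⟨_, ⟨U, hU, rfl⟩, hxU, -⟩ :=
    X.isBasis_affineOpens.exists_subset_of_mem_open (Set.mem_univ x) isOpen_univ
  exact ⟨⟨U, hU⟩, hxU, 1, one_mem _, by simp⟩

/-- Up to a unit, a generator of the extended ideal lies in `J`; finite generation lets one `s`
clear all denominators. -/
theorem _root_.Ideal.exists_forall_mul_mem_span_singleton {R A : Type*} [CommRing R] [CommRing A]
    [Algebra R A] (p : Ideal R) [p.IsPrime] [IsLocalization.AtPrime A p] [IsPrincipalIdealRing A]
    (J : Ideal R) (hJ : J.FG) : ∃ t ∈ J, ∃ s ∉ p, ∀ a ∈ J, s * a ∈ Ideal.span {t} := by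
  obtain ⟨a, ha⟩ := IsPrincipalIdealRing.principal (J.map (algebraMap R A))
  obtain ⟨⟨⟨t, htJ⟩, m⟩, htm⟩ := (IsLocalization.mem_map_algebraMap_iff p.primeCompl A).mp
    (show a ∈ J.map (algebraMap R A) from ha ▸ Submodule.mem_span_singleton_self a)
  have hle : J ≤ ((Ideal.span {t}).map (algebraMap R A)).comap (algebraMap R A) := by
    intro b hb
    have hb' : algebraMap R A b ∈ Ideal.span {a} := by
      rw [Ideal.span, ← ha]
      exact Ideal.mem_map_of_mem _ hb
    obtain ⟨c, hc⟩ := Ideal.mem_span_singleton'.mp hb'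
    rw [Ideal.mem_comap, Ideal.map_span, Set.image_singleton, ← htm, ← hc]
    refine Ideal.mul_mem_left _ _ (Ideal.mem_span_singleton.mpr ?_)
    exact (IsUnit.mul_right_dvd (IsLocalization.map_units A m)).mpr dvd_rfl
  refine ⟨t, htJ, ?_⟩
  clear ha htm htJ
  induction J, hJ using Submodule.fg_induction with
  | singleton b =>
    have hb := Ideal.mem_comap.mp (hle <| Submodule.mem_span_singleton_self b)
    obtain ⟨s, hs, h⟩ := (IsLocalization.algebraMap_mem_map_algebraMap_iff p.primeCompl _ _ _).mp hb
    refine ⟨s, hs, fun a ha => ?_⟩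
    obtain ⟨c, rfl⟩ := Submodule.mem_span_singleton.mp ha
    rw [smul_eq_mul, mul_left_comm]
    exact Ideal.mul_mem_left _ _ h
  | sup J₁ J₂ _ _ h1 h2 =>
    obtain ⟨s₁, hs₁, h₁⟩ := h1 (le_sup_left.trans hle)
    obtain ⟨s₂, hs₂, h₂⟩ := h2 (le_sup_right.trans hle)
    refine ⟨s₁ * s₂, p.primeCompl.mul_mem hs₁ hs₂, fun a ha => ?_⟩
    obtain ⟨b, hb, c, hc, rfl⟩ := Submodule.mem_sup.mp ha
    have : s₁ * s₂ * (b + c) = s₂ * (s₁ * b) + s₁ * (s₂ * c) := by ring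
    rw [this]
    exact add_mem (Ideal.mul_mem_left _ _ (h₁ b hb)) (Ideal.mul_mem_left _ _ (h₂ c hc))

/-- A generator at the stalk spreads out to a basic open neighbourhood. -/
theorem isEffectiveCartier_of_isPrincipalIdealRing_stalk [IsIntegral X] [IsLocallyNoetherian X]
    (hX : ∀ x : X, IsPrincipalIdealRing (X.presheaf.stalk x)) (I : X.IdealSheafData)
    (hI : I ≠ ⊥) : IsEffectiveCartier I := by
  intro x
  obtain ⟨_, ⟨U, hU, rfl⟩, hxU, -⟩ :=
    X.isBasis_affineOpens.exists_subset_of_mem_open (Set.mem_univ x) isOpen_univ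
  have : Nonempty U := ⟨⟨x, hxU⟩⟩
  have hnoeth : IsNoetherianRing Γ(X, U) := IsLocallyNoetherian.component_noetherian ⟨U, hU⟩
  let _ := TopCat.Presheaf.algebra_section_stalk X.presheaf (⟨x, hxU⟩ : U)
  have hloc := hU.isLocalization_stalk ⟨x, hxU⟩
  let p := (hU.primeIdealOf ⟨x, hxU⟩).asIdeal
  let J := I.ideal ⟨U, hU⟩
  have hJ : J ≠ ⊥ := by
    refine fun h => hI (Scheme.IdealSheafData.support_eq_top_iff.mp ?_)
    have hsub : (U : Set X) ⊆ I.support := fun y hy => by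
      refine (I.mem_support_iff_of_mem (U := ⟨U, hU⟩) hy).mpr ?_
      change y ∈ X.zeroLocus (J : Set Γ(X, U))
      simp [h, Scheme.mem_zeroLocus_iff]
    refine SetLike.coe_injective (Set.univ_subset_iff.mp ?_)
    rw [← (U.2.dense ⟨x, hxU⟩).closure_eq]
    exact I.support.isClosed.closure_subset_iff.mpr hsub
  have := hX x
  obtain ⟨t, htJ, s, hs, hsJ⟩ := Ideal.exists_forall_mul_mem_span_singleton
    (A := X.presheaf.stalk x) p J (IsNoetherian.noetherian J)
  have hs0 : s ≠ 0 := fun h => hs (h ▸ p.zero_mem)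
  have ht0 : t ≠ 0 := by
    rintro rfl
    refine hJ ((Submodule.eq_bot_iff _).mpr fun a ha => ?_)
    simpa [hs0] using hsJ a ha
  have hxs : x ∈ X.basicOpen s := by
    rw [Scheme.mem_basicOpen X s x hxU]
    exact (IsLocalization.AtPrime.isUnit_to_map_iff (X.presheaf.stalk x) p s).mpr hs
  have : Nonempty (X.basicOpen s) := ⟨⟨x, hxs⟩⟩
  refine ⟨X.affineBasicOpen (U := ⟨U, hU⟩) s, hxs,
    X.presheaf.map (homOfLE (X.basicOpen_le s)).op t, ?_, ?_⟩
  · have : IsDomain Γ(X, X.basicOpen s) := inferInstance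
    exact mem_nonZeroDivisors_of_ne_zero (M₀ := Γ(X, X.basicOpen s)) ((map_ne_zero_iff _
      (map_injective_of_isIntegral X (homOfLE (X.basicOpen_le s)))).mpr ht0)
  · refine (I.map_ideal_basicOpen ⟨U, hU⟩ s).symm.trans ?_
    let r : Γ(X, U) →+* Γ(X, X.basicOpen s) := (X.presheaf.map (homOfLE (X.basicOpen_le s)).op).hom
    have hr : IsUnit (r s) := RingedSpace.isUnit_res_basicOpen _ s
    change J.map r = Ideal.span {r t}
    apply le_antisymm
    · rw [Ideal.map_le_iff_le_comap]
      intro a ha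
      have h1 := Ideal.mem_map_of_mem r (hsJ a ha)
      rw [Ideal.map_span, Set.image_singleton, map_mul] at h1
      exact (Ideal.unit_mul_mem_iff_mem _ hr).mp h1
    · rw [Ideal.span_singleton_le_iff_mem]
      exact Ideal.mem_map_of_mem _ htJ

/-- The complement of a Cartier divisor is scheme-theoretically dense: it contains each `D(t)`, and
restriction to `D(t)` is injective for a nonzerodivisor `t`. -/
theorem IsEffectiveCartier.ker_ι_compl_support {I : X.IdealSheafData} (hI : IsEffectiveCartier I) :
    (Scheme.Opens.ι I.support.compl).ker = ⊥ := by
  choose U hxU t ht hIt using hI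
  refine Scheme.IdealSheafData.ext_of_iSup_eq_top U ?_ fun x => ?_
  · exact eq_top_iff.mpr fun x _ => Opens.mem_iSup.mpr ⟨x, hxU x⟩
  · refine le_antisymm ((Scheme.Hom.ideal_ker_le _ _).trans fun a ha => ?_) bot_le
    have hle : X.basicOpen (t x) ≤ I.support.compl := by
      intro y hy hyI
      replace hyI : y ∈ I.support := hyI
      rw [I.mem_support_iff_of_mem (U := U x) (X.basicOpen_le _ hy)] at hyI
      refine (Scheme.mem_zeroLocus_iff _ _ _).mp hyI (t x) ?_ hy
      rw [hIt]
      exact Ideal.mem_span_singleton_self _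
    have := (U x).2.isLocalization_basicOpen (t x)
    refine IsLocalization.injective Γ(X, X.basicOpen (t x)) (Submonoid.powers_le.mpr (ht x)) ?_
    let W : X.Opens := I.support.compl
    have h0 : X.presheaf.map (homOfLE (W.ι.image_preimage_le _)).op a = 0 := ha
    have hle' : X.basicOpen (t x) ≤ W.ι ''ᵁ W.ι ⁻¹ᵁ (U x).1 := by
      rw [Scheme.Hom.image_preimage_eq_opensRange_inf, Scheme.Opens.opensRange_ι]
      exact le_inf hle (X.basicOpen_le _)
    rw [map_zero]
    have h1 := congr(X.presheaf.map (homOfLE hle').op $h0)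
    rw [map_zero, ← ConcreteCategory.comp_apply, ← Functor.map_comp] at h1
    exact h1

end AlgSemigroup

/-! ### The shear of a group object and descent of integrality -/

namespace CategoryTheory.GrpObj

variable {𝒞 : Type*} [Category 𝒞] [CartesianMonoidalCategory 𝒞]

open _root_.CategoryTheory.MonObj in
/-- The shear automorphism `(x, y) ↦ (x, x * y)` of `G × G`. -/
noncomputable def shear (G : 𝒞) [GrpObj G] : G ⊗ G ≅ G ⊗ G where
  hom := lift (fst G G) μ
  inv := lift (fst G G) ((fst G G)⁻¹ * snd G G)
  hom_inv_id := by
    have : (μ : G ⊗ G ⟶ G) = fst G G * snd G G := by rw [Hom.mul_def]; simp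
    ext <;> simp [MonObj.comp_mul, GrpObj.comp_inv, this]
  inv_hom_id := by
    have : (μ : G ⊗ G ⟶ G) = fst G G * snd G G := by rw [Hom.mul_def]; simp
    ext <;> simp [MonObj.comp_mul, this]

end CategoryTheory.GrpObj

namespace AlgebraicGeometry

theorem irreducibleSpace_of_isDominant {X Y : Scheme.{0}} (f : X ⟶ Y) [IsDominant f]
    [IrreducibleSpace X] : IrreducibleSpace Y := by
  have h := ((IrreducibleSpace.isIrreducible_univ X).image f f.continuous.continuousOn).closure
  rw [Set.image_univ, f.denseRange.closure_eq] at h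
  exact { isPreirreducible_univ := h.2, toNonempty := ⟨h.1.some⟩ }

theorem isIntegral_of_isSchemeTheoreticallyDominant {X Y : Scheme.{0}} (f : X ⟶ Y) [QuasiCompact f]
    [IsSchemeTheoreticallyDominant f] [IsIntegral X] : IsIntegral Y :=
  have := IsSchemeTheoreticallyDominant.isReduced f
  have := irreducibleSpace_of_isDominant f
  isIntegral_of_irreducibleSpace_of_isReduced Y

end AlgebraicGeometry

/-! ### Contraction laws and flatness of kernel laws -/

namespace AlgSemigroup

theorem isSemigroupLaw_contractionLaw {S C : SchC} {π : S ⟶ C} {σ : C ⟶ S} {ν : C ⊗ C ⟶ C}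
    (h : σ ≫ π = 𝟙 C) (hν : IsSemigroupLaw ν) : IsSemigroupLaw (contractionLaw π σ ν) := by
  unfold IsSemigroupLaw contractionLaw at *
  have h1 : ((π ⊗ₘ π) ≫ ν ≫ σ) ▷ S ≫ (π ⊗ₘ π) = ((π ⊗ₘ π) ⊗ₘ π) ≫ ν ▷ C := by
    rw [← tensorHom_id, ← tensorHom_id, tensorHom_comp_tensorHom, tensorHom_comp_tensorHom,
      Category.assoc, Category.assoc, h, Category.comp_id, Category.comp_id, Category.id_comp]
  have h2 : S ◁ ((π ⊗ₘ π) ≫ ν ≫ σ) ≫ (π ⊗ₘ π) = (π ⊗ₘ (π ⊗ₘ π)) ≫ C ◁ ν := by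
    rw [← id_tensorHom, ← id_tensorHom, tensorHom_comp_tensorHom, tensorHom_comp_tensorHom,
      Category.assoc, Category.assoc, h, Category.comp_id, Category.comp_id, Category.id_comp]
  rw [reassoc_of% h1, reassoc_of% h2, reassoc_of% hν, associator_naturality_assoc]

theorem IsKernelLaw.isSemigroupLaw {C : SchC} {ν : C ⊗ C ⟶ C} (h : IsKernelLaw ν) :
    IsSemigroupLaw ν := by
  obtain ⟨G, rfl⟩ | rfl | rfl := h
  · exact MonObj.mul_assoc C
  · simp [IsSemigroupLaw]
  · simp [IsSemigroupLaw]

theorem isSemigroupHom_contractionLaw {S' S C : SchC} (φ : S' ⟶ S) {π : S ⟶ C} {σ : C ⟶ S}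
    {σ' : C ⟶ S'} (h : σ' ≫ φ = σ) (ν : C ⊗ C ⟶ C) :
    IsSemigroupHom (contractionLaw (φ ≫ π) σ' ν) (contractionLaw π σ ν) φ := by
  simp [IsSemigroupHom, contractionLaw, h]

theorem flat_hom (X : SchC) : Flat X.hom := inferInstance

theorem flat_tensorHom_left {A B C D : SchC} (f : A ⟶ B) (g : C ⟶ D) [Flat f.left] [Flat g.left] :
    Flat (f ⊗ₘ g).left := by
  rw [Over.tensorHom_left]
  exact MorphismProperty.pullbackMap (P := @Flat) ‹_› ‹_› (Over.w f).symm (Over.w g).symm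

/-- Projections are flat over a field, and a group law is the shear automorphism followed by a
projection. -/
theorem IsKernelLaw.flat {C : SchC} {ν : C ⊗ C ⟶ C} (h : IsKernelLaw ν) : Flat ν.left := by
  have := flat_hom C
  have hfst : Flat (fst C C).left := inferInstanceAs (Flat (Limits.pullback.fst C.hom C.hom))
  have hsnd : Flat (snd C C).left := inferInstanceAs (Flat (Limits.pullback.snd C.hom C.hom))
  obtain ⟨G, rfl⟩ | rfl | rfl := h
  · have h : G.mul = (GrpObj.shear C).hom ≫ snd C C := by simp [GrpObj.shear]
    rw [h, Over.comp_left]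
    have : IsIso (GrpObj.shear C).hom.left :=
      inferInstanceAs (IsIso ((Over.forget _).map (GrpObj.shear C).hom))
    infer_instance
  · exact hfst
  · exact hsnd

/-! ### Consequences of the universal property of the blow-up -/

section BlowUp

variable {X' X : Scheme.{0}} {φ : X' ⟶ X} {p : X} {hp : IsClosed ({p} : Set X)}

theorem mem_support_pointIdeal_comap {T : Scheme.{0}} (f : T ⟶ X) (x : T) :
    x ∈ ((pointIdeal p hp).comap f).support ↔ f x = p := by
  rw [Scheme.IdealSheafData.support_comap, ← SetLike.mem_coe, Closeds.coe_preimage, pointIdeal,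
    Scheme.IdealSheafData.coe_support_vanishingIdeal]
  simp

theorem isEffectiveCartier_comap_of_ne {T : Scheme.{0}} (f : T ⟶ X) (hf : ∀ x, f x ≠ p) :
    IsEffectiveCartier ((pointIdeal p hp).comap f) := by
  have : (pointIdeal p hp).comap f = ⊤ := by
    rw [← Scheme.IdealSheafData.support_eq_bot_iff, eq_bot_iff]
    exact fun x hx => hf x ((mem_support_pointIdeal_comap f x).mp hx)
  rw [this]
  exact isEffectiveCartier_top

theorem IsBlowUpAt.hom_ext (h : IsBlowUpAt φ p hp) {T : Scheme.{0}} {f g : T ⟶ X'}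
    (hf : IsEffectiveCartier ((pointIdeal p hp).comap (f ≫ φ))) (hfg : f ≫ φ = g ≫ φ) : f = g :=
  (h.existsUnique_lift T (f ≫ φ) hf).unique rfl hfg.symm

/-- The complement of a closed point. -/
noncomputable def complPoint (p : X) (hp : IsClosed ({p} : Set X)) : X.Opens := (⟨{p}, hp⟩ : Closeds X).compl

/-- Away from `p` the inverse image of the point is empty, hence Cartier, so the lift exists and
inverts `φ` there. -/
theorem IsBlowUpAt.exists_lift_compl (h : IsBlowUpAt φ p hp) :
    ∃ s : (complPoint p hp).toScheme ⟶ X', s ≫ φ = (complPoint p hp).ι ∧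
      (φ ∣_ complPoint p hp) ≫ s = (φ ⁻¹ᵁ complPoint p hp).ι := by
  obtain ⟨s, hs, -⟩ := h.existsUnique_lift _ (complPoint p hp).ι
    (isEffectiveCartier_comap_of_ne _ fun x => x.2)
  refine ⟨s, hs, (h.hom_ext (isEffectiveCartier_comap_of_ne _ ?_) ?_).symm⟩
  · exact fun x => x.2
  · rw [Category.assoc, hs, morphismRestrict_ι]

theorem IsBlowUpAt.eq_of_apply_eq (h : IsBlowUpAt φ p hp) {x y : X'} (hxy : φ x = φ y)
    (hx : φ x ≠ p) : x = y := by
  obtain ⟨s, -, hs⟩ := h.exists_lift_compl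
  have key (z : X') (hz : φ z ≠ p) : s ⟨φ z, hz⟩ = z := by
    have h1 : (φ ∣_ complPoint p hp) ⟨z, hz⟩ = ⟨φ z, hz⟩ :=
      Subtype.ext congr($(morphismRestrict_ι φ (complPoint p hp)) ⟨z, hz⟩)
    rw [← h1]
    exact (Scheme.Hom.comp_apply _ _ _).symm.trans congr($hs ⟨z, hz⟩)
  have h2 : (⟨φ x, hx⟩ : complPoint p hp) = ⟨φ y, hxy ▸ hx⟩ := Subtype.ext hxy
  rw [← key x hx, ← key y (hxy ▸ hx), h2]

theorem IsBlowUpAt.isIntegral (h : IsBlowUpAt φ p hp) [IsIntegral X] [NoetherianSpace X]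
    (hX : ∃ x : X, x ≠ p) : IsIntegral X' := by
  obtain ⟨x, hx⟩ := hX
  have : Nonempty (complPoint p hp) := ⟨⟨x, hx⟩⟩
  obtain ⟨s, -, hs⟩ := h.exists_lift_compl
  have hker := h.isEffectiveCartier.ker_ι_compl_support
  have hopen : ((pointIdeal p hp).comap φ).support.compl = φ ⁻¹ᵁ complPoint p hp := by
    ext x
    exact (mem_support_pointIdeal_comap φ x).not
  -- The inclusion of the complement of the exceptional divisor is scheme-theoretically dominant and
  -- factors through `s`.
  have : IsSchemeTheoreticallyDominant s := by
    refine ⟨eq_bot_iff.mpr ?_⟩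
    rw [hopen, ← hs] at hker
    rw [← hker]
    exact Scheme.Hom.le_ker_comp _ _
  have : NoetherianSpace (complPoint p hp).toScheme :=
    (complPoint p hp).ι.isOpenEmbedding.isInducing.noetherianSpace
  exact isIntegral_of_isSchemeTheoreticallyDominant s

end BlowUp

/-! ### Finiteness properties of the surface and the curve -/

theorem isSeparated_projectiveSpace (n : ℕ) : IsSeparated (projectiveSpace n).hom := by
  unfold projectiveSpace
  dsimp
  infer_instance

theorem quasiCompact_projectiveSpace (n : ℕ) : QuasiCompact (projectiveSpace n).hom := by
  unfold projectiveSpace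
  dsimp
  let _ := MvPolynomial.gradedAlgebra (σ := Fin (n + 1)) (R := ℂ)
  have : IsScalarTower ℂ (MvPolynomial.homogeneousSubmodule (Fin (n + 1)) ℂ 0)
    (MvPolynomial (Fin (n + 1)) ℂ) := by
    refine ⟨fun a x y => ?_⟩
    change ((a • x : MvPolynomial.homogeneousSubmodule (Fin (n + 1)) ℂ 0) : MvPolynomial _ ℂ) * y =
      a • ((x : MvPolynomial _ ℂ) * y)
    rw [Submodule.coe_smul, smul_mul_assoc]
  have : Algebra.FiniteType (MvPolynomial.homogeneousSubmodule (Fin (n + 1)) ℂ 0)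
    (MvPolynomial (Fin (n + 1)) ℂ) := .of_restrictScalars_finiteType ℂ _ _
  infer_instance

theorem IsProjective.isSeparated {X : SchC} (h : IsProjective X) : IsSeparated X.hom := by
  obtain ⟨n, i, hi⟩ := h
  have := isSeparated_projectiveSpace n
  rw [← Over.w i]
  infer_instance

theorem IsProjective.quasiCompact {X : SchC} (h : IsProjective X) : QuasiCompact X.hom := by
  obtain ⟨n, i, hi⟩ := h
  have := quasiCompact_projectiveSpace n
  rw [← Over.w i]
  infer_instance

theorem IsSmoothProjectiveSurface.isNoetherian {S : SchC} (h : IsSmoothProjectiveSurface S) :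
    IsNoetherian S.left := by
  have := h.smooth
  have := h.projective.quasiCompact
  have := LocallyOfFiniteType.isLocallyNoetherian S.hom
  have : CompactSpace S.left := QuasiCompact.compactSpace_of_compactSpace S.hom
  exact { }

theorem IsCompleteCurve.isNoetherian {C : SchC} (h : IsCompleteCurve C) : IsNoetherian C.left := by
  have := h.proper
  have := LocallyOfFiniteType.isLocallyNoetherian C.hom
  have : CompactSpace C.left := QuasiCompact.compactSpace_of_compactSpace C.hom
  exact { }

theorem IsCompleteCurve.isPrincipalIdealRing_stalk {S C : SchC} [IsIntegral S.left]
    (hS : Smooth S.hom) (hC : IsCompleteCurve C) {π : S ⟶ C} {σ : C ⟶ S} (h : σ ≫ π = 𝟙 C)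
    (c : C.left) : IsPrincipalIdealRing (C.left.presheaf.stalk c) := by
  have := hC.isIntegral
  have := hC.isNoetherian
  have := isIntegrallyClosed_stalk_of_smooth S.hom (σ.left c)
  have := isIntegrallyClosed_stalk_of_section π.left σ.left congr(($h).left) c
  have := krullDimLE_stalk (n := 1) hC.dim_eq_one.le c
  exact isPrincipalIdealRing_of_krullDimLE_one _

theorem exists_ne_of_topologicalKrullDim_pos {X : Type*} [TopologicalSpace X]
    (h : 0 < topologicalKrullDim X) (x : X) : ∃ y, y ≠ x := by
  by_contra! hx
  have : Subsingleton X := ⟨fun a b => (hx a).trans (hx b).symm⟩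
  exact h.not_ge (topologicalKrullDim_zero_of_discreteTopology X)

/-! ### Lifting the section to the blow-up -/

section Section

variable {X' X C B : Scheme.{0}} {φ : X' ⟶ X} {p : X} {hp : IsClosed ({p} : Set X)}
  {π : X ⟶ C} {σ : C ⟶ X} {τ : C ⟶ X'}

theorem injective_of_section (h : σ ≫ π = 𝟙 C) : Function.Injective σ :=
  Function.LeftInverse.injective (g := π) fun c => congr($h c)

/-- The closed subscheme of the image cut out by the kernel of `f.toImage` has the same ideal in `Y`
as the image itself. -/
theorem isSchemeTheoreticallyDominant_toImage {X Y : Scheme.{0}} (f : X ⟶ Y) :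
    IsSchemeTheoreticallyDominant f.toImage := by
  let k := f.toImage.ker.subschemeι
  have hk : (k ≫ f.imageι).ker ≤ f.imageι.ker := by
    rw [Scheme.Hom.ker_comp, Scheme.IdealSheafData.ker_subschemeι, ← Scheme.Hom.ker_comp,
      f.toImage_imageι]
    exact (Scheme.IdealSheafData.ker_subschemeι _).ge
  have hid : IsClosedImmersion.lift (k ≫ f.imageι) f.imageι hk ≫ k = 𝟙 _ := by
    rw [← cancel_mono f.imageι, Category.assoc, IsClosedImmersion.lift_fac, Category.id_comp]
  have : IsIso k := ⟨_, by rw [← cancel_mono k, Category.assoc, hid]; simp, hid⟩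
  exact ⟨(Scheme.isIso_subschemeι_iff_eq_bot _).mp this⟩

theorem isDominant_of_comp_eq_id {X Y : Scheme.{0}} {i : Y ⟶ X} {f : X ⟶ Y} (h : i ≫ f = 𝟙 Y) :
    IsDominant f :=
  ⟨Function.Surjective.denseRange fun y => ⟨i y, congr($h y)⟩⟩

theorem isEffectiveCartier_comap_section [IsIntegral C] [IsLocallyNoetherian C]
    (hC : ∀ c : C, IsPrincipalIdealRing (C.presheaf.stalk c)) (hne : ∃ c, σ c ≠ p) :
    IsEffectiveCartier ((pointIdeal p hp).comap σ) := by
  refine isEffectiveCartier_of_isPrincipalIdealRing_stalk hC _ fun hbot => ?_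
  obtain ⟨c, hc⟩ := hne
  refine hc ((mem_support_pointIdeal_comap (hp := hp) σ c).mp ?_)
  rw [hbot, Scheme.IdealSheafData.support_bot]
  trivial

/-- The scheme-theoretic image of `τ` retracts onto `C` by `q`, flat because `C` has principal
stalks. Uniqueness of lifts then forces `q ≫ τ` to be the inclusion of the image, so `C` is that
image. -/
theorem IsBlowUpAt.isClosedImmersion_lift (hφ : IsBlowUpAt φ p hp) [IsIntegral C] [IsNoetherian C]
    (hC : ∀ c : C, IsPrincipalIdealRing (C.presheaf.stalk c)) (h : σ ≫ π = 𝟙 C)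
    (hσ : IsEffectiveCartier ((pointIdeal p hp).comap σ)) (hτ : τ ≫ φ = σ)
    (s : X ⟶ B) [IsSeparated s] (hs : π ≫ σ ≫ s = s) : IsClosedImmersion τ := by
  let g := τ.imageι
  let j := τ.toImage
  let q := g ≫ φ ≫ π
  have hjg : j ≫ g = τ := τ.toImage_imageι
  have hjq : j ≫ q = 𝟙 C := by rw [reassoc_of% hjg, reassoc_of% hτ, h]
  have : IsSchemeTheoreticallyDominant j := isSchemeTheoreticallyDominant_toImage τ
  have : IsIntegral τ.image := isIntegral_of_isSchemeTheoreticallyDominant j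
  have : IsDominant q := isDominant_of_comp_eq_id hjq
  have : Flat q := flat_of_isDominant q hC
  have hqφ : (q ≫ τ) ≫ φ = g ≫ φ := by
    -- Both sides agree on the dominant `j`, the image is reduced, and `X` is separated over `B`.
    refine ext_of_isDominant_of_isSeparated s ?_ j ?_
    · simp [q, reassoc_of% hτ, hs]
    · simp [q, reassoc_of% hjg, reassoc_of% hτ, reassoc_of% h, hτ]
  have hqτ : q ≫ τ = g := by
    refine hφ.hom_ext ?_ hqφ
    rw [Category.assoc, hτ, Scheme.IdealSheafData.comap_comp]
    exact hσ.comap_of_flat q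
  have : IsIso j := ⟨q, hjq, by rw [← cancel_mono g, Category.assoc, hjg, hqτ, Category.id_comp]⟩
  rw [← hjg]
  infer_instance

/-- The points of `C` not sent to `p` are dense, the range of `τ` is closed, and `φ` is injective
away from `p`. -/
theorem IsBlowUpAt.range_lift (hφ : IsBlowUpAt φ p hp) [IsIntegral C] [IsClosedImmersion τ]
    (hτ : τ ≫ φ = σ) (hne : ∃ c, σ c ≠ p) :
    Set.range τ = strictTransform φ p (Set.range σ) := by
  have hφτ (c : C) : φ (τ c) = σ c := congr($hτ c)
  apply subset_antisymm
  · let W : Set C := σ ⁻¹' {p}ᶜ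
    have hW : Dense W := (hp.isOpen_compl.preimage σ.continuous).dense hne
    rw [← Set.image_univ, ← hW.closure_eq]
    refine (image_closure_subset_closure_image τ.continuous).trans (closure_mono ?_)
    rintro _ ⟨c, hc, rfl⟩
    exact ⟨⟨c, (hφτ c).symm⟩, (hφτ c).symm ▸ hc⟩
  · refine closure_minimal ?_ τ.isClosedEmbedding.isClosed_range
    rintro x ⟨⟨c, hc⟩, hx⟩
    exact ⟨c, hφ.eq_of_apply_eq ((hφτ c).trans hc) (by rw [hφτ, hc]; exact hx)⟩

end Section

end AlgSemigroup

/-! ### The main theorem -/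

theorem mainTheorem11
    (S : AlgSemigroup.SchC) (hS : AlgSemigroup.IsSmoothProjectiveSurface S)
    (C : AlgSemigroup.SchC) (μ : S ⊗ S ⟶ S) (π : S ⟶ C) (σ : C ⟶ S) (ν : C ⊗ C ⟶ C)
    (hμ : AlgSemigroup.IsNontrivialPresentation μ π σ ν)
    (P : S.left) (hP : IsClosed ({P} : Set S.left))
    (S' : AlgSemigroup.SchC) (φ : S' ⟶ S) (hφ : AlgSemigroup.IsBlowUpAt φ.left P hP) :
    (∃! μ' : S' ⊗ S' ⟶ S', AlgSemigroup.IsSemigroupLaw μ' ∧ AlgSemigroup.IsNontrivialLaw μ' ∧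
      AlgSemigroup.IsSemigroupHom μ' μ φ) ∧
    ∃ σ' : C ⟶ S',
      IsClosedImmersion σ'.left ∧
      Set.range σ'.left =
        AlgSemigroup.strictTransform φ.left P (Set.range σ.left) ∧
      σ' ≫ φ = σ ∧
      AlgSemigroup.IsSemigroupLaw (AlgSemigroup.contractionLaw (φ ≫ π) σ' ν) ∧
      AlgSemigroup.IsNontrivialPresentation (AlgSemigroup.contractionLaw (φ ≫ π) σ' ν)
        (φ ≫ π) σ' ν ∧
      AlgSemigroup.IsSemigroupHom (AlgSemigroup.contractionLaw (φ ≫ π) σ' ν) μ φ := by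
  obtain ⟨hC, hsec, hν, rfl⟩ := hμ
  have := hS.isIntegral
  have := hS.isNoetherian
  have := hS.projective.isSeparated
  have := hC.isIntegral
  have := hC.isNoetherian
  have hsec' : σ.left ≫ π.left = 𝟙 C.left := congr(($hsec).left)
  have hpir := hC.isPrincipalIdealRing_stalk hS.smooth hsec
  have hne : ∃ c, σ.left c ≠ P := by
    obtain ⟨c₀⟩ : Nonempty C.left := inferInstance
    obtain ⟨c, hc⟩ := AlgSemigroup.exists_ne_of_topologicalKrullDim_pos
      (hC.dim_eq_one ▸ zero_lt_one) c₀
    by_contra! h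
    exact hc (AlgSemigroup.injective_of_section hsec' ((h c).trans (h c₀).symm))
  have hσ := AlgSemigroup.isEffectiveCartier_comap_section (hp := hP) hpir hne
  obtain ⟨τ, hτ, -⟩ := hφ.existsUnique_lift _ σ.left hσ
  let σ' : C ⟶ S' := Over.homMk τ (by rw [← Over.w φ, reassoc_of% hτ, Over.w])
  have hσ' : σ' ≫ φ = σ := Over.OverMorphism.ext hτ
  have hsec'' : σ' ≫ φ ≫ π = 𝟙 C := by rw [reassoc_of% hσ', hsec]
  have : IsIntegral S'.left := hφ.isIntegral (hne.imp' _ fun _ => id)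
  have hpres : AlgSemigroup.IsNontrivialPresentation
      (AlgSemigroup.contractionLaw (φ ≫ π) σ' ν) (φ ≫ π) σ' ν := ⟨hC, hsec'', hν, rfl⟩
  have hlaw := AlgSemigroup.isSemigroupLaw_contractionLaw hsec'' hν.isSemigroupLaw
  have hhom := AlgSemigroup.isSemigroupHom_contractionLaw φ (π := π) hσ' ν
  have hcl : IsClosedImmersion σ'.left := hφ.isClosedImmersion_lift hpir hsec' hσ hτ S.hom (by simp)
  refine ⟨⟨_, ⟨hlaw, ⟨C, _, σ', ν, hpres⟩, hhom⟩, fun μ' hμ' => ?_⟩,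
    σ', hcl, hφ.range_lift hτ hne, hσ', hlaw, hpres, hhom⟩
  have : IsDominant (φ ≫ π).left :=
    AlgSemigroup.isDominant_of_comp_eq_id (i := σ'.left) congr(($hsec'').left)
  have : Flat (φ ≫ π).left := flat_of_isDominant _ hpir
  have := AlgSemigroup.flat_tensorHom_left (φ ≫ π) (φ ≫ π)
  have := hν.flat
  -- Both laws agree after `φ`; it remains to see that `P` pulls back to a Cartier divisor on `S' ×
  -- S'`.
  refine (Over.OverMorphism.ext (hφ.hom_ext ?_ congr(($(hhom.trans hμ'.2.2.symm)).left))).symm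
  have h1 : (AlgSemigroup.contractionLaw (φ ≫ π) σ' ν).left ≫ φ.left =
      (((φ ≫ π) ⊗ₘ (φ ≫ π)).left ≫ ν.left) ≫ σ.left := by
    rw [AlgSemigroup.contractionLaw, ← hσ']
    simp only [Over.comp_left, Category.assoc]
  rw [h1, Scheme.IdealSheafData.comap_comp]
  exact hσ.comap_of_flat _
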